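/- Let $\mu\in\mathbb R$, $\sigma>0$, $\lambda\ge 0$, $\Delta t>0$, and let $p$ be a probability density on $\mathbb R$ (the density of the jump size $\xi$). Put $$\kappa=\int_{\mathbb R}(e^{y}-1)\,p(y)\,dy,\quad \alpha=\tfrac{\sigma^2}{2}\Delta t,\quad \beta=\bigl(\mu-\lambda\kappa-\tfrac{\sigma^2}{2}\bigr)\Delta t,\quad \theta=-\lambda\Delta t,\quad \Gamma(\eta)=\int_{\mathbb R}p(y)e^{i\eta y}\,dy,$$ $$G(\eta;\Delta t)=\exp\Bigl(\Delta t\bigl(-\tfrac{\sigma^2\eta^2}{2}+(\mu-\lambda\kappa-\tfrac{\sigma^2}{2})\,i\eta-\lambda+\lambda\Gamma(\eta)\bigr)\Bigr),\qquad g(s;\Delta t)=\frac1{2\pi}\int_{\mathbb R}e^{i\eta s}G(\eta;\Delta t)\,d\eta .$$ For $k\ge0$ let $$T_k(s)=\frac{1}{\sqrt{4\pi\alpha}}\,\frac{(\lambda\Delta t)^k}{k!}\int_{\mathbb R^k}\exp\Bigl(\theta-\frac{(\beta+s+y_1+\dots+y_k)^2}{4\alpha}\Bigr)\prod_{\ell=1}^k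 p(y_\ell)\,dy_1\cdots dy_k ,$$ $g(s;\Delta t,\infty)=\sum_{k\ge0}T_k(s)$ and $g(s;\Delta t,0)=\dfrac{1}{\sqrt{4\pi\alpha}}\exp\bigl(\theta-\frac{(\beta+s)^2}{4\alpha}\bigr)$. In each of the two cases below, the integrals defining $\kappa$, $g(s;\Delta t)$ and all $T_k(s)$ converge absolutely and, for every $s\in\mathbb R$, $g(s;\Delta t)=g(s;\Delta t,\infty)$, $T_0(s)=g(s;\Delta t,0)$, $T_k(s)=\Delta g_k(s;\Delta t)$ for all $k\ge1$, and $$g(s;\Delta t,\infty)=g(s;\Delta t,0)+\sum_{k=1}^\infty \Delta g_k(s;\Delta t)$$ with a convergent series, where $\Delta g_k$ is as follows. (i) Normal jumps, $p(y)=\frac{1}{\sqrt{2\pi\tilde\sigma^2}}\exp\bigl(-\frac{(y-\tilde\mu)^2}{2\tilde\sigma^2}\bigr)$ with $\tilde\mu\in\mathbb R$, $\tilde\sigma>0$: $$\Delta g_k(s;\Delta t)=\frac{(\lambda\Delta t)^k}{k!}\,\frac{\exp\Bigl(\theta-\frac{(\beta+s+k\tilde\mu)^2}{4\alpha+2k\tilde\sigma^2}\Bigr)}{\sqrt{4\pi\alpha+2\pi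 k\tilde\sigma^2}} .$$ (ii) Asymmetric double-exponential jumps, $p(y)=q_1\eta_1e^{-\eta_1y}\mathbf 1_{\{y\ge0\}}+q_2\eta_2e^{\eta_2y}\mathbf 1_{\{y<0\}}$ with $q_1\in(0,1)$, $q_2=1-q_1$, $\eta_1>1$, $\eta_2>0$: $$\Delta g_k(s;\Delta t)=\frac{e^\theta}{\sqrt{4\pi\alpha}}\frac{(\lambda\Delta t)^k}{k!}\Bigl[\sum_{\ell=1}^kQ_1^{k,\ell}(\eta_1\sqrt{2\alpha})^\ell e^{\eta_1(\beta+s)+\eta_1^2\alpha}\,\mathrm{Hh}_{\ell-1}\Bigl(\eta_1\sqrt{2\alpha}+\tfrac{\beta+s}{\sqrt{2\alpha}}\Bigr)+\sum_{\ell=1}^kQ_2^{k,\ell}(\eta_2\sqrt{2\alpha})^\ell e^{-\eta_2(\beta+s)+\eta_2^2\alpha}\,\mathrm{Hh}_{\ell-1}\Bigl(\eta_2\sqrt{2\alpha}-\tfrac{\beta+s}{\sqrt{2\alpha}}\Bigr)\Bigr],$$ where $Q_1^{k,k}=q_1^k$, $Q_2^{k,k}=q_2^k$ and, for $1\le\ell\le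 k-1$, $$Q_1^{k,\ell}=\sum_{i=\ell}^{k-1}\binom{k-\ell-1}{i-\ell}\binom ki\Bigl(\frac{\eta_1}{\eta_1+\eta_2}\Bigr)^{i-\ell}\Bigl(\frac{\eta_2}{\eta_1+\eta_2}\Bigr)^{k-i}q_1^iq_2^{k-i},$$ $$Q_2^{k,\ell}=\sum_{i=\ell}^{k-1}\binom{k-\ell-1}{i-\ell}\binom ki\Bigl(\frac{\eta_1}{\eta_1+\eta_2}\Bigr)^{k-i}\Bigl(\frac{\eta_2}{\eta_1+\eta_2}\Bigr)^{i-\ell}q_1^{k-i}q_2^i,$$ and $\mathrm{Hh}_\ell(x)=\frac1{\ell!}\int_x^\infty(y-x)^\ell e^{-y^2/2}\,dy$ for $\ell\ge0$, $\mathrm{Hh}_{-1}(x)=e^{-x^2/2}$. In particular $\mathrm{Hh}_0(x)=\sqrt{2\pi}\,\Phi(-x)$ for all $x\in\mathbb R$, where $\Phi$ is the standard normal distribution function. -/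

import Mathlib

open MeasureTheory

noncomputable section

namespace JumpDiffusion

/-- Data of the log-price dynamics
`dS = (μ - λκ - σ²/2) dt + σ dW + d(∑_{ℓ ≤ π_t} ξ_ℓ)`:
the drift `μ`, the volatility `σ`, the jump intensity `λ` (written `lam`) and the
probability density `p` of the jump size `ξ`. -/
structure Model where
  mu : ℝ
  sigma : ℝ
  lam : ℝ
  p : ℝ → ℝ

namespace Model

variable (M : Model) (dt : ℝ)

/-- `κ = E[e^ξ - 1]`. -/
def kappa : ℝ := ∫ y, (Real.exp y - 1) * M.p y

/-- `α = (σ²/2) Δt`. -/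
def alpha : ℝ := M.sigma ^ 2 / 2 * dt

/-- `β = (μ - λκ - σ²/2) Δt`. -/
def beta : ℝ := (M.mu - M.lam * M.kappa - M.sigma ^ 2 / 2) * dt

/-- `θ = -λ Δt`. -/
def theta : ℝ := -(M.lam * dt)

/-- `Γ(η) = ∫ p(y) e^{iηy} dy`. -/
def jumpCharFun (η : ℝ) : ℂ :=
  ∫ y : ℝ, (M.p y : ℂ) * Complex.exp (Complex.I * η * y)

/-- `Ψ(η) = -σ²η²/2 + (μ - λκ - σ²/2)(iη) - λ + λ Γ(η)`. -/
def psi (η : ℝ) : ℂ :=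
  -((M.sigma : ℂ) ^ 2 * (η : ℂ) ^ 2 / 2)
    + ((M.mu - M.lam * M.kappa - M.sigma ^ 2 / 2 : ℝ) : ℂ) * (Complex.I * η)
    - M.lam + M.lam * M.jumpCharFun η

/-- `G(η; Δt) = exp(Ψ(η) Δt)`. -/
def bigG (η : ℝ) : ℂ := Complex.exp (M.psi η * dt)

/-- The conditional density `g(s; Δt)`, i.e. the inverse Fourier transform
`(1/2π) ∫ e^{iηs} G(η; Δt) dη`, as a complex number. -/
def density (s : ℝ) : ℂ :=
  1 / (2 * (Real.pi : ℂ)) * ∫ η : ℝ, Complex.exp (Complex.I * η * s) * M.bigG dt η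

/-- The integrand `exp(θ - (β + s + y₁ + ⋯ + y_k)² / (4α)) ∏ p(y_ℓ)` of the `k`-fold integral. -/
def seriesIntegrand (k : ℕ) (s : ℝ) (y : Fin k → ℝ) : ℝ :=
  Real.exp (M.theta dt - (M.beta dt + s + ∑ l, y l) ^ 2 / (4 * M.alpha dt)) * ∏ l, M.p (y l)

/-- The `k`-th term of the infinite series representation of `g`: the number
`(1/√(4πα)) ((λΔt)^k / k!) ∫⋯∫ exp(θ - (β + s + Y_k)²/(4α)) ∏ p(y_ℓ) dy₁⋯dy_k`. -/
def seriesTerm (k : ℕ) (s : ℝ) : ℝ :=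
  1 / Real.sqrt (4 * Real.pi * M.alpha dt) * ((M.lam * dt) ^ k / (k.factorial : ℝ)) *
    ∫ y : Fin k → ℝ, M.seriesIntegrand dt k s y

/-- The infinite series `g(s; Δt, ∞)`, summed over all `k ≥ 0`. -/
def gInf (s : ℝ) : ℝ := ∑' k : ℕ, M.seriesTerm dt k s

/-- `g(s; Δt, 0) = exp(θ - (β + s)²/(4α)) / √(4πα)`. -/
def gZero (s : ℝ) : ℝ :=
  Real.exp (M.theta dt - (M.beta dt + s) ^ 2 / (4 * M.alpha dt)) /
    Real.sqrt (4 * Real.pi * M.alpha dt)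

end Model

/-- Density of the normal distribution with mean `m` and standard deviation `v`. -/
def normalPdf (m v : ℝ) (y : ℝ) : ℝ :=
  1 / Real.sqrt (2 * Real.pi * v ^ 2) * Real.exp (-((y - m) ^ 2 / (2 * v ^ 2)))

/-- Density of the asymmetric double-exponential distribution:
`q₁ η₁ e^{-η₁ y}` for `y ≥ 0` and `(1 - q₁) η₂ e^{η₂ y}` for `y < 0`. -/
def doubleExpPdf (q1 eta1 eta2 : ℝ) (y : ℝ) : ℝ :=
  if 0 ≤ y then q1 * eta1 * Real.exp (-(eta1 * y))
  else (1 - q1) * eta2 * Real.exp (eta2 * y)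

/-- The model with normally distributed jumps. -/
def merton (mu sigma lam m v : ℝ) : Model := ⟨mu, sigma, lam, normalPdf m v⟩

/-- The model with asymmetric double-exponential jumps. -/
def kou (mu sigma lam q1 eta1 eta2 : ℝ) : Model := ⟨mu, sigma, lam, doubleExpPdf q1 eta1 eta2⟩

/-- The functions `Hh_ℓ(x) = (1/ℓ!) ∫_x^∞ (y - x)^ℓ e^{-y²/2} dy` for `ℓ ≥ 0`, and
`Hh_{-1}(x) = e^{-x²/2}`. (Indices below `-1` do not occur.) -/
def Hh : ℤ → ℝ → ℝ
  | Int.ofNat l, x =>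
      1 / (l.factorial : ℝ) * ∫ y in Set.Ioi x, (y - x) ^ l * Real.exp (-(1 / 2 * y ^ 2))
  | Int.negSucc _, x => Real.exp (-(x ^ 2 / 2))

/-- The coefficient `Q₁^{k,ℓ}`, `1 ≤ ℓ ≤ k`. -/
def Q1 (q1 eta1 eta2 : ℝ) (k l : ℕ) : ℝ :=
  if l = k then q1 ^ k
  else ∑ i ∈ Finset.Icc l (k - 1),
    ((k - l - 1).choose (i - l) : ℝ) * (k.choose i : ℝ) *
      (eta1 / (eta1 + eta2)) ^ (i - l) * (eta2 / (eta1 + eta2)) ^ (k - i) *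
      q1 ^ i * (1 - q1) ^ (k - i)

/-- The coefficient `Q₂^{k,ℓ}`, `1 ≤ ℓ ≤ k`. -/
def Q2 (q1 eta1 eta2 : ℝ) (k l : ℕ) : ℝ :=
  if l = k then (1 - q1) ^ k
  else ∑ i ∈ Finset.Icc l (k - 1),
    ((k - l - 1).choose (i - l) : ℝ) * (k.choose i : ℝ) *
      (eta1 / (eta1 + eta2)) ^ (k - i) * (eta2 / (eta1 + eta2)) ^ (i - l) *
      q1 ^ (k - i) * (1 - q1) ^ i

/-- Closed form of `Δg_k(s; Δt)` for normal jumps. -/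
def mertonDeltaG (mu sigma lam m v dt : ℝ) (k : ℕ) (s : ℝ) : ℝ :=
  let M := merton mu sigma lam m v
  (lam * dt) ^ k / (k.factorial : ℝ) *
    (Real.exp (M.theta dt -
        (M.beta dt + s + k * m) ^ 2 / (4 * M.alpha dt + 2 * k * v ^ 2)) /
      Real.sqrt (4 * Real.pi * M.alpha dt + 2 * Real.pi * k * v ^ 2))

/-- Closed form of `Δg_k(s; Δt)` for asymmetric double-exponential jumps. -/
def kouDeltaG (mu sigma lam q1 eta1 eta2 dt : ℝ) (k : ℕ) (s : ℝ) : ℝ :=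
  let M := kou mu sigma lam q1 eta1 eta2
  let a := M.alpha dt
  let b := M.beta dt
  Real.exp (M.theta dt) / Real.sqrt (4 * Real.pi * a) * ((lam * dt) ^ k / (k.factorial : ℝ)) *
    ((∑ l ∈ Finset.Icc 1 k, Q1 q1 eta1 eta2 k l * (eta1 * Real.sqrt (2 * a)) ^ l *
        Real.exp (eta1 * (b + s) + eta1 ^ 2 * a) *
        Hh ((l : ℤ) - 1) (eta1 * Real.sqrt (2 * a) + (b + s) / Real.sqrt (2 * a))) +
     (∑ l ∈ Finset.Icc 1 k, Q2 q1 eta1 eta2 k l * (eta2 * Real.sqrt (2 * a)) ^ l *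
        Real.exp (-(eta2 * (b + s)) + eta2 ^ 2 * a) *
        Hh ((l : ℤ) - 1) (eta2 * Real.sqrt (2 * a) - (b + s) / Real.sqrt (2 * a))))

end JumpDiffusion

end

/-! In `G` the factor `exp(λΔtΓ)` expands as a power series, so `g` becomes a sum of Fourier
integrals of a Gaussian times `Γ^k`. Since `|Γ| ≤ ∫|p|`, the terms are dominated by an exponential
series times an integrable Gaussian, and sum and integral may be exchanged
(`Model.hasSum_seriesTerm`). As `Γ^k` is the characteristic function of `y₁ + ⋯ + y_k`, Fubini and
the Gaussian Fourier integral identify the `k`-th integral with `T_k`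
(`integral_gaussChar_mul_charInt`).

The same identity gives the closed forms once `Γ` is explicit. For normal jumps `Γ^k` times the
Gaussian is again a Gaussian. For double-exponential jumps `Γ = q₁P + q₂N` with `P = η₁/(η₁ - iη)`,
`N = η₂/(η₂ + iη)`. Here `PN` is a linear combination of `P` and `N`, so the binomial theorem and
partial fractions turn `Γ^k` into pure powers of `P` and of `N`, with coefficients `Q₁`, `Q₂`
(`add_pow_eq_sum_Q`). Each power is the characteristic function of an Erlang variable or of its
negative, and its integral against the Gaussian is an `Hh` function
(`integral_erlangPdf_mul_gaussian`). -/

noncomputable section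

namespace JumpDiffusion

/-! ### Gaussian Fourier integrals -/

/-- The Fourier transform of a centred Gaussian, translated by `c`. -/
def gaussChar (a c η : ℝ) : ℂ := Complex.exp (Complex.I * η * c - a * (η : ℂ) ^ 2)

/-- The function `η ↦ ∫ h(x) e^{iηY(x)} dν(x)`. -/
def charInt {X : Type*} [MeasurableSpace X] (ν : Measure X) (h Y : X → ℝ) (η : ℝ) : ℂ :=
  ∫ x, (h x : ℂ) * Complex.exp (Complex.I * η * Y x) ∂ν

lemma norm_exp_I_mul_mul (x y : ℝ) : ‖Complex.exp (Complex.I * x * y)‖ = 1 := by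
  rw [Complex.norm_exp]; simp

lemma norm_gaussChar (a c η : ℝ) : ‖gaussChar a c η‖ = Real.exp (-a * η ^ 2) := by
  rw [gaussChar, Complex.norm_exp]
  congr 1
  have : (Complex.I * η * c - a * (η : ℂ) ^ 2) =
      ((-a * η ^ 2 : ℝ) : ℂ) + ((η * c : ℝ) : ℂ) * Complex.I := by push_cast; ring
  rw [this]
  simp only [Complex.add_re, Complex.re_ofReal_mul, Complex.I_re, Complex.ofReal_re, mul_zero,
    add_zero]

lemma continuous_gaussChar (a c : ℝ) : Continuous (gaussChar a c) := by
  unfold gaussChar; fun_prop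

lemma integrable_gaussChar {a : ℝ} (ha : 0 < a) (c : ℝ) : Integrable (gaussChar a c) := by
  refine (integrable_exp_neg_mul_sq ha).mono' (continuous_gaussChar a c).aestronglyMeasurable ?_
  exact Filter.Eventually.of_forall fun η => (norm_gaussChar a c η).le

lemma integral_gaussChar {a : ℝ} (ha : 0 < a) (c : ℝ) :
    ∫ η, gaussChar a c η =
      ((Real.sqrt (Real.pi / a) * Real.exp (-(c ^ 2 / (4 * a))) : ℝ) : ℂ) := by
  have h := fourierIntegral_gaussian (b := (a : ℂ)) (by simpa using ha) (c : ℂ)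
  have e : ∀ η : ℝ, gaussChar a c η =
      Complex.exp (Complex.I * c * η) * Complex.exp (-(a : ℂ) * (η : ℂ) ^ 2) := by
    intro η
    rw [gaussChar, ← Complex.exp_add]
    congr 1; ring
  simp_rw [e]
  rw [h, Real.sqrt_eq_rpow, Complex.ofReal_mul, Complex.ofReal_cpow (by positivity),
    Complex.ofReal_exp]
  push_cast
  congr 2
  ring

lemma gaussChar_mul_exp (a c y η : ℝ) :
    gaussChar a c η * Complex.exp (Complex.I * η * y) = gaussChar a (c + y) η := by
  rw [gaussChar, gaussChar, ← Complex.exp_add]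
  congr 1; push_cast; ring

/-! ### Gaussians against characteristic functions -/

section charInt

variable {X : Type*} [MeasurableSpace X] {ν : Measure X} {h Y : X → ℝ}

lemma norm_charInt_le (η : ℝ) : ‖charInt ν h Y η‖ ≤ ∫ x, |h x| ∂ν := by
  refine (norm_integral_le_integral_norm _).trans (le_of_eq ?_)
  congr 1; ext x
  rw [norm_mul, norm_exp_I_mul_mul, mul_one, Complex.norm_real, Real.norm_eq_abs]

lemma continuous_charInt (hh : Integrable h ν) (hY : Measurable Y) :
    Continuous (charInt ν h Y) := by
  refine continuous_of_dominated (bound := fun x => |h x|) ?_ ?_ hh.abs ?_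
  · intro η
    exact hh.ofReal.aestronglyMeasurable.mul (by fun_prop)
  · intro η
    refine Filter.Eventually.of_forall fun x => le_of_eq ?_
    rw [norm_mul, norm_exp_I_mul_mul, mul_one, Complex.norm_real, Real.norm_eq_abs]
  · refine Filter.Eventually.of_forall fun x => ?_
    fun_prop

lemma integrable_gaussChar_mul_charInt (hh : Integrable h ν) (hY : Measurable Y)
    {a : ℝ} (ha : 0 < a) (c : ℝ) :
    Integrable fun η => gaussChar a c η * charInt ν h Y η :=
  (integrable_gaussChar ha c).mul_bdd (continuous_charInt hh hY).aestronglyMeasurable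
    (Filter.Eventually.of_forall norm_charInt_le)

lemma integrable_mul_exp_neg_sq (hh : Integrable h ν) (hY : Measurable Y)
    {a : ℝ} (ha : 0 < a) (c : ℝ) :
    Integrable (fun x => h x * Real.exp (-((c + Y x) ^ 2 / (4 * a)))) ν := by
  refine hh.mul_bdd (c := 1) (by fun_prop) (Filter.Eventually.of_forall fun x => ?_)
  rw [Real.norm_eq_abs, Real.abs_exp, Real.exp_le_one_iff]
  have : 0 ≤ (c + Y x) ^ 2 / (4 * a) := by positivity
  linarith

/-- Fubini applies because the phase has modulus one; the inner integral over `η` is then a Gaussian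
one with centre `c + Y x`. -/
lemma integral_gaussChar_mul_charInt [SFinite ν] (hh : Integrable h ν) (hY : Measurable Y)
    {a : ℝ} (ha : 0 < a) (c : ℝ) :
    ∫ η, gaussChar a c η * charInt ν h Y η =
      ((Real.sqrt (Real.pi / a) * ∫ x, h x * Real.exp (-((c + Y x) ^ 2 / (4 * a))) ∂ν : ℝ) : ℂ) := by
  have hint : Integrable (Function.uncurry fun (η : ℝ) (x : X) =>
      gaussChar a c η * ((h x : ℂ) * Complex.exp (Complex.I * η * Y x))) (volume.prod ν) := by
    have h1 := (integrable_gaussChar ha c).mul_prod (hh.ofReal (𝕜 := ℂ))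
    have h2 := h1.mul_bdd (c := 1)
      (g := fun z : ℝ × X => Complex.exp (Complex.I * (z.1 : ℂ) * (Y z.2 : ℂ)))
      (by fun_prop) (Filter.Eventually.of_forall fun z => (norm_exp_I_mul_mul _ _).le)
    refine h2.congr (Filter.Eventually.of_forall fun z => ?_)
    simp only [Function.uncurry, mul_assoc]
    rfl
  calc ∫ η, gaussChar a c η * charInt ν h Y η
      = ∫ η, ∫ x, gaussChar a c η * ((h x : ℂ) * Complex.exp (Complex.I * η * Y x)) ∂ν := by
        simp_rw [charInt, integral_const_mul]
    _ = ∫ x, (∫ η : ℝ, gaussChar a c η * ((h x : ℂ) * Complex.exp (Complex.I * η * Y x))) ∂ν :=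
        integral_integral_swap hint
    _ = ∫ x, ((Real.sqrt (Real.pi / a) *
          (h x * Real.exp (-((c + Y x) ^ 2 / (4 * a)))) : ℝ) : ℂ) ∂ν := by
        congr 1; ext x
        have : ∀ η : ℝ, gaussChar a c η * ((h x : ℂ) * Complex.exp (Complex.I * η * Y x)) =
            (h x : ℂ) * gaussChar a (c + Y x) η := by
          intro η; rw [← gaussChar_mul_exp]; ring
        simp_rw [this, integral_const_mul, integral_gaussChar ha]
        push_cast; ring
    _ = _ := by rw [integral_complex_ofReal, integral_const_mul]

end charInt

/-! ### Series expansion for an integrable jump density -/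

namespace Model

variable {M : Model} {dt : ℝ}

lemma alpha_pos (hs : 0 < M.sigma) (hdt : 0 < dt) : 0 < M.alpha dt := by
  unfold alpha; positivity

lemma jumpCharFun_eq (η : ℝ) : M.jumpCharFun η = charInt volume M.p id η := rfl

lemma jumpCharFun_pow (k : ℕ) (η : ℝ) :
    M.jumpCharFun η ^ k =
      charInt volume (fun y : Fin k → ℝ => ∏ l, M.p (y l)) (fun y => ∑ l, y l) η := by
  have := integral_fintype_prod_eq_pow (ι := Fin k) (μ := (volume : Measure ℝ))
    (fun y : ℝ => (M.p y : ℂ) * Complex.exp (Complex.I * η * y))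
  rw [Fintype.card_fin] at this
  rw [jumpCharFun, ← this, charInt]
  congr 1; ext y
  rw [Finset.prod_mul_distrib, ← Complex.exp_sum]
  push_cast
  rw [Finset.mul_sum]

lemma integrable_prod_density (hp : Integrable M.p) (k : ℕ) :
    Integrable (fun y : Fin k → ℝ => ∏ l, M.p (y l)) :=
  Integrable.fintype_prod (fun _ => hp)

lemma bigG_eq (η : ℝ) :
    M.bigG dt η = Real.exp (M.theta dt) * (gaussChar (M.alpha dt) (M.beta dt) η *
      Complex.exp (M.lam * dt * M.jumpCharFun η)) := by
  rw [bigG, psi, gaussChar, Complex.ofReal_exp, ← Complex.exp_add, ← Complex.exp_add]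
  congr 1
  simp only [alpha, beta, theta]
  push_cast; ring

lemma norm_jumpCharFun_le (η : ℝ) : ‖M.jumpCharFun η‖ ≤ ∫ y, |M.p y| := by
  rw [jumpCharFun_eq]; exact norm_charInt_le η

lemma integrable_bigG (hs : 0 < M.sigma) (hdt : 0 < dt) (hp : Integrable M.p) :
    Integrable (M.bigG dt) := by
  have hc : Continuous M.jumpCharFun := continuous_charInt hp measurable_id
  have h := ((integrable_gaussChar (alpha_pos hs hdt) (M.beta dt)).mul_bdd
    (g := fun η => Complex.exp (M.lam * dt * M.jumpCharFun η))
    (c := Real.exp (|M.lam| * dt * ∫ y, |M.p y|)) (by fun_prop)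
    (Filter.Eventually.of_forall fun η => ?_)).const_mul (Real.exp (M.theta dt) : ℂ)
  · exact h.congr (Filter.Eventually.of_forall fun η => (bigG_eq η).symm)
  · refine (Complex.norm_exp_le_exp_norm _).trans (Real.exp_le_exp.2 ?_)
    rw [norm_mul, norm_mul, Complex.norm_real, Complex.norm_real, Real.norm_eq_abs,
      Real.norm_eq_abs, abs_of_pos hdt]
    gcongr
    exact norm_jumpCharFun_le η

lemma seriesIntegrand_eq (k : ℕ) (s : ℝ) (y : Fin k → ℝ) :
    M.seriesIntegrand dt k s y = Real.exp (M.theta dt) * ((∏ l, M.p (y l)) *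
      Real.exp (-((M.beta dt + s + ∑ l, y l) ^ 2 / (4 * M.alpha dt)))) := by
  rw [seriesIntegrand, sub_eq_add_neg, Real.exp_add]; ring

lemma integrable_seriesIntegrand (hs : 0 < M.sigma) (hdt : 0 < dt) (hp : Integrable M.p)
    (k : ℕ) (s : ℝ) : Integrable (M.seriesIntegrand dt k s) := by
  have h := (integrable_mul_exp_neg_sq (integrable_prod_density hp k)
    (Y := fun y : Fin k → ℝ => ∑ l, y l) (by fun_prop) (alpha_pos hs hdt)
    (M.beta dt + s)).const_mul (Real.exp (M.theta dt))
  exact h.congr (Filter.Eventually.of_forall fun y => (seriesIntegrand_eq k s y).symm)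

/-- Reconciles the heat-kernel normalisation with the Fourier constant `1/(2π)` times the Gaussian
mass `√(π/a)`. -/
lemma one_div_sqrt_four_pi_mul {a : ℝ} (ha : 0 < a) :
    1 / Real.sqrt (4 * Real.pi * a) = 1 / (2 * Real.pi) * Real.sqrt (Real.pi / a) := by
  have hpi := Real.pi_pos
  have e : Real.pi / a = (2 * Real.pi) ^ 2 / (4 * Real.pi * a) := by field_simp; ring
  rw [e, Real.sqrt_div' _ (by positivity), Real.sqrt_sq (by positivity)]
  field_simp

/-- Serves twice: to sum the series over `k`, and to evaluate each term when `Γ` is known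
explicitly. -/
lemma integral_gaussChar_mul_jumpCharFun_pow (hs : 0 < M.sigma) (hdt : 0 < dt)
    (hp : Integrable M.p) (k : ℕ) (s : ℝ) :
    (M.seriesTerm dt k s : ℂ) =
      ((1 / (2 * Real.pi) * ((M.lam * dt) ^ k / k.factorial) * Real.exp (M.theta dt) : ℝ) : ℂ) *
        ∫ η, gaussChar (M.alpha dt) (M.beta dt + s) η * M.jumpCharFun η ^ k := by
  simp_rw [jumpCharFun_pow]
  rw [integral_gaussChar_mul_charInt (integrable_prod_density hp k) (by fun_prop)
    (alpha_pos hs hdt), ← Complex.ofReal_mul, seriesTerm,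
    one_div_sqrt_four_pi_mul (alpha_pos hs hdt)]
  simp_rw [seriesIntegrand_eq, integral_const_mul]
  congr 1; ring

lemma integrable_gaussChar_mul_jumpCharFun_pow (hs : 0 < M.sigma) (hdt : 0 < dt)
    (hp : Integrable M.p) (k : ℕ) (c : ℝ) :
    Integrable fun η => gaussChar (M.alpha dt) c η * M.jumpCharFun η ^ k := by
  simp_rw [jumpCharFun_pow]
  exact integrable_gaussChar_mul_charInt (integrable_prod_density hp k) (by fun_prop)
    (alpha_pos hs hdt) c

lemma hasSum_seriesTerm (hs : 0 < M.sigma) (hdt : 0 < dt) (hp : Integrable M.p) (s : ℝ) :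
    HasSum (fun k => (M.seriesTerm dt k s : ℂ)) (M.density dt s) := by
  set a := M.alpha dt with ha_def
  have ha : 0 < a := alpha_pos hs hdt
  set c := M.beta dt + s with hc
  set F : ℕ → ℝ → ℂ := fun k η =>
    ((M.lam * dt : ℝ) : ℂ) ^ k / k.factorial * (gaussChar a c η * M.jumpCharFun η ^ k) with hF
  have hFi : ∀ k, Integrable (F k) := fun k =>
    (integrable_gaussChar_mul_jumpCharFun_pow hs hdt hp k c).const_mul _
  set B := ∫ y, |M.p y| with hB
  have hB0 : 0 ≤ B := integral_nonneg fun _ => abs_nonneg _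
  have hnorm : ∀ k, ∫ η, ‖F k η‖ ≤
      (|M.lam * dt| * B) ^ k / k.factorial * ∫ η, ‖gaussChar a c η‖ := by
    intro k
    rw [← integral_const_mul]
    refine integral_mono (hFi k).norm ((integrable_gaussChar ha c).norm.const_mul _) fun η => ?_
    simp only [hF, norm_mul, norm_div, norm_pow, Complex.norm_real, Real.norm_eq_abs,
      Complex.norm_natCast]
    have h1 : ‖M.jumpCharFun η‖ ^ k ≤ B ^ k := by
      gcongr; exact norm_jumpCharFun_le η
    calc (|M.lam| * |dt|) ^ k / k.factorial * (‖gaussChar a c η‖ * ‖M.jumpCharFun η‖ ^ k)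
        ≤ (|M.lam| * |dt|) ^ k / k.factorial * (‖gaussChar a c η‖ * B ^ k) :=
          mul_le_mul_of_nonneg_left (mul_le_mul_of_nonneg_left h1 (norm_nonneg _)) (by positivity)
      _ = (|M.lam * dt| * B) ^ k / k.factorial * ‖gaussChar a c η‖ := by
          rw [abs_mul, mul_pow _ B]; ring
  have hsum : Summable fun k => ∫ η, ‖F k η‖ :=
    Summable.of_nonneg_of_le (fun k => integral_nonneg fun _ => norm_nonneg _) hnorm
      ((Real.summable_pow_div_factorial _).mul_right _)
  have key := (hasSum_integral_of_summable_integral_norm hFi hsum).mul_left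
    ((1 / (2 * Real.pi) * Real.exp (M.theta dt) : ℝ) : ℂ)
  have hterm : (fun k => (M.seriesTerm dt k s : ℂ)) = fun k =>
      ((1 / (2 * Real.pi) * Real.exp (M.theta dt) : ℝ) : ℂ) * ∫ η, F k η := by
    ext k
    rw [integral_gaussChar_mul_jumpCharFun_pow hs hdt hp]
    simp only [hF]
    rw [integral_const_mul]
    push_cast; ring
  have hdens : M.density dt s =
      ((1 / (2 * Real.pi) * Real.exp (M.theta dt) : ℝ) : ℂ) * ∫ η, ∑' k, F k η := by
    have hint : ∫ η : ℝ, Complex.exp (Complex.I * η * s) * M.bigG dt η =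
        (Real.exp (M.theta dt) : ℂ) * ∫ η, ∑' k, F k η := by
      rw [← integral_const_mul]
      refine integral_congr_ae (Filter.Eventually.of_forall fun η => ?_)
      simp only
      have : ∑' k, F k η = gaussChar a c η * Complex.exp (M.lam * dt * M.jumpCharFun η) := by
        have h1 := (NormedSpace.expSeries_div_hasSum_exp
          ((M.lam : ℂ) * dt * M.jumpCharFun η)).mul_left (gaussChar a c η)
        rw [← Complex.exp_eq_exp_ℂ] at h1
        rw [← h1.tsum_eq]
        congr 1; ext k
        simp only [hF]
        push_cast
        rw [mul_pow]; ring
      rw [this, bigG_eq, hc, ← gaussChar_mul_exp]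
      ring
    rw [Model.density, hint]
    push_cast; ring
  rw [hterm, hdens]
  exact key

/-- The series representation of the density, with the closed form `D` of the `k`-th term. -/
lemma series_representation (hs : 0 < M.sigma) (hdt : 0 < dt) (hp : Integrable M.p) (s : ℝ)
    (D : ℕ → ℝ) (hD : ∀ k, 1 ≤ k → M.seriesTerm dt k s = D k) :
    M.density dt s = (M.gInf dt s : ℂ) ∧
      (∀ k : ℕ, Integrable (M.seriesIntegrand dt k s)) ∧
      M.seriesTerm dt 0 s = M.gZero dt s ∧
      (∀ k : ℕ, 1 ≤ k → M.seriesTerm dt k s = D k) ∧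
      Summable (fun k : ℕ => D (k + 1)) ∧
      M.gInf dt s = M.gZero dt s + ∑' k : ℕ, D (k + 1) := by
  have hsum := hasSum_seriesTerm hs hdt hp s
  have hS : Summable fun k => M.seriesTerm dt k s := Complex.summable_ofReal.1 hsum.summable
  have h0 : M.seriesTerm dt 0 s = M.gZero dt s := by
    -- The 0-fold integral runs over a one-point space of mass one.
    simp [seriesTerm, seriesIntegrand, gZero, div_eq_inv_mul, Measure.real, volume_pi]
  have hD' : (fun k : ℕ => D (k + 1)) = fun k => M.seriesTerm dt (k + 1) s := by
    ext k; exact (hD (k + 1) (by omega)).symm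
  refine ⟨?_, fun k => integrable_seriesIntegrand hs hdt hp k s, h0, hD, ?_, ?_⟩
  · rw [gInf, Complex.ofReal_tsum, hsum.tsum_eq]
  · rw [hD']; exact (summable_nat_add_iff 1).2 hS
  · rw [hD', gInf, hS.tsum_eq_zero_add, h0]

end Model

/-! ### Normal jumps -/

lemma normalPdf_eq_gaussianPDFReal (m v : ℝ) :
    normalPdf m v = ProbabilityTheory.gaussianPDFReal m (v ^ 2).toNNReal := by
  ext y
  simp only [normalPdf, ProbabilityTheory.gaussianPDFReal, one_div, neg_div,
    Real.coe_toNNReal _ (sq_nonneg v)]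

lemma integrable_normalPdf (m v : ℝ) : Integrable (normalPdf m v) := by
  rw [normalPdf_eq_gaussianPDFReal]
  exact ProbabilityTheory.integrable_gaussianPDFReal _ _

lemma integrable_exp_sub_one_mul_normalPdf (m : ℝ) {v : ℝ} (hv : 0 < v) :
    Integrable (fun y => (Real.exp y - 1) * normalPdf m v y) := by
  have hv2 : 0 < 1 / (2 * v ^ 2) := by positivity
  -- The coefficients come from expanding `y - (y - m)²/(2v²)` in powers of `y`.
  have h := (integrable_cexp_quadratic (b := ((1 / (2 * v ^ 2) : ℝ) : ℂ)) (by exact_mod_cast hv2)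
    ((m / v ^ 2 + 1 : ℝ) : ℂ) ((-(m ^ 2 / (2 * v ^ 2)) : ℝ) : ℂ)).re.const_mul
    (1 / Real.sqrt (2 * Real.pi * v ^ 2))
  refine (h.sub (integrable_normalPdf m v)).congr (Filter.Eventually.of_forall fun y => ?_)
  have : (-((1 / (2 * v ^ 2) : ℝ) : ℂ) * (y : ℂ) ^ 2 + ((m / v ^ 2 + 1 : ℝ) : ℂ) * y +
      ((-(m ^ 2 / (2 * v ^ 2)) : ℝ) : ℂ)) = ((y + -((y - m) ^ 2 / (2 * v ^ 2)) : ℝ) : ℂ) := by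
    rw [show y + -((y - m) ^ 2 / (2 * v ^ 2)) =
      -(1 / (2 * v ^ 2)) * y ^ 2 + (m / v ^ 2 + 1) * y + -(m ^ 2 / (2 * v ^ 2)) by
        field_simp; ring]
    push_cast; ring
  simp only [Pi.sub_apply, normalPdf]
  rw [this, ← Complex.ofReal_exp]
  simp only [Complex.ofReal_re, RCLike.re_to_complex]
  rw [Real.exp_add]; ring

lemma jumpCharFun_merton (mu sigma lam m : ℝ) {v : ℝ} (hv : 0 < v) (η : ℝ) :
    (merton mu sigma lam m v).jumpCharFun η =
      Complex.exp (Complex.I * η * m - v ^ 2 * (η : ℂ) ^ 2 / 2) := by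
  have h := ProbabilityTheory.charFun_gaussianReal (μ := m) (v := (v ^ 2).toNNReal) η
  have hv0 : (v ^ 2).toNNReal ≠ 0 := (Real.toNNReal_pos.2 (pow_pos hv 2)).ne'
  rw [charFun_apply_real, ProbabilityTheory.integral_gaussianReal_eq_integral_smul hv0,
    ← normalPdf_eq_gaussianPDFReal] at h
  rw [Model.jumpCharFun]
  simp only [merton]
  refine Eq.trans ?_ (h.trans ?_)
  · congr 1; ext y
    rw [Complex.real_smul]
    congr 2; ring
  · congr 1
    rw [Real.coe_toNNReal _ (sq_nonneg v)]
    push_cast; ring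

/-- Multiplying by `Γ^k` only changes the Gaussian's parameters: `α` becomes `α + kv²/2` and the
shift gains `km`. -/
lemma merton_seriesTerm {sigma dt : ℝ} (hs : 0 < sigma) (hdt : 0 < dt) (mu lam m : ℝ) {v : ℝ}
    (hv : 0 < v) (k : ℕ) (s : ℝ) :
    (merton mu sigma lam m v).seriesTerm dt k s = mertonDeltaG mu sigma lam m v dt k s := by
  have hsM : 0 < (merton mu sigma lam m v).sigma := hs
  have ha := Model.alpha_pos hsM hdt
  apply Complex.ofReal_injective
  rw [Model.integral_gaussChar_mul_jumpCharFun_pow hsM hdt (integrable_normalPdf m v)]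
  simp_rw [jumpCharFun_merton _ _ _ _ hv]
  simp only [mertonDeltaG]
  set M := merton mu sigma lam m v
  have hlam : M.lam = lam := rfl
  set a := M.alpha dt
  set b := M.beta dt
  have hA : 0 < a + k * v ^ 2 / 2 := by positivity
  have e : ∀ η : ℝ, gaussChar a (b + s) η *
      Complex.exp (Complex.I * η * m - v ^ 2 * (η : ℂ) ^ 2 / 2) ^ k =
      gaussChar (a + k * v ^ 2 / 2) (b + s + k * m) η := by
    intro η
    rw [gaussChar, gaussChar, ← Complex.exp_nat_mul, ← Complex.exp_add]
    congr 1; push_cast; ring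
  simp_rw [e]
  rw [integral_gaussChar hA, ← Complex.ofReal_mul, hlam]
  congr 1
  rw [show 4 * Real.pi * a + 2 * Real.pi * k * v ^ 2 = 4 * Real.pi * (a + k * v ^ 2 / 2) by ring,
    show 4 * a + 2 * k * v ^ 2 = 4 * (a + k * v ^ 2 / 2) by ring, sub_eq_add_neg, Real.exp_add,
    div_eq_mul_one_div (_ * _) (Real.sqrt _), Model.one_div_sqrt_four_pi_mul hA]
  ring

/-! ### Partial fractions of `P ^ i * N ^ j` -/

section PartialFractions

variable {K : Type*} [Field K]

/-- The part in powers of `P` of the partial fraction expansion of `P ^ i * N ^ j`,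
when `P * N = s * P + r * N`. -/
def partialFractionPart (r s P : K) (i j : ℕ) : K :=
  ∑ m ∈ Finset.range i, ((m + j - 1).choose m : K) * s ^ j * r ^ m * P ^ (i - m)

lemma partialFractionPart_zero_left (r s P : K) (j : ℕ) : partialFractionPart r s P 0 j = 0 := by
  simp [partialFractionPart]

/-- Truncated subtraction matters here: the coefficient is `C(0,0) = 1` at `m = 0`, and `C(m-1,m) =
0` for `m ≥ 1`. -/
lemma partialFractionPart_zero_right (r s P : K) (i : ℕ) :
    partialFractionPart r s P (i + 1) 0 = P ^ (i + 1) := by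
  rw [partialFractionPart, Finset.sum_range_succ', Finset.sum_eq_zero]
  · simp
  · intro m _
    rw [show m + 1 + 0 - 1 = m by omega, Nat.choose_succ_self]; simp

/-- Pascal's rule, mirroring `P^(i+1) N^(j+1) = s P^(i+1) N^j + r P^i N^(j+1)`. -/
lemma partialFractionPart_succ_succ (r s P : K) (i j : ℕ) :
    partialFractionPart r s P (i + 1) (j + 1) =
      s * partialFractionPart r s P (i + 1) j + r * partialFractionPart r s P i (j + 1) := by
  simp only [partialFractionPart]
  rw [Finset.sum_range_succ', Finset.sum_range_succ' (n := i), mul_add, Finset.mul_sum,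
    Finset.mul_sum, add_right_comm, ← Finset.sum_add_distrib]
  congr 1
  · refine Finset.sum_congr rfl fun m _ => ?_
    rw [show m + 1 + (j + 1) - 1 = m + j + 1 by omega, show m + 1 + j - 1 = m + j by omega,
      show m + (j + 1) - 1 = m + j by omega, show i + 1 - (m + 1) = i - m by omega,
      Nat.choose_succ_succ]
    push_cast; ring
  · simp; ring

/-- Both sides obey the same recursion in `(i, j)`. Total degree zero is excluded: there the product
is `1` but both parts vanish. -/
lemma pow_mul_pow_eq_partialFractionPart {r s P N : K} (h : P * N = s * P + r * N) (n : ℕ) :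
    ∀ i j : ℕ, i + j = n + 1 →
      P ^ i * N ^ j = partialFractionPart r s P i j + partialFractionPart s r N j i := by
  induction n with
  | zero =>
    intro i j hij
    obtain ⟨rfl, rfl⟩ | ⟨rfl, rfl⟩ : (i = 0 ∧ j = 0 + 1) ∨ (i = 0 + 1 ∧ j = 0) := by omega
    · rw [partialFractionPart_zero_left, partialFractionPart_zero_right]; simp
    · rw [partialFractionPart_zero_left, partialFractionPart_zero_right]; simp
  | succ n ih =>
    intro i j hij
    rcases i with _ | i
    · rcases j with _ | j
      · omega
      · rw [partialFractionPart_zero_left, partialFractionPart_zero_right]; simp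
    · rcases j with _ | j
      · rw [partialFractionPart_zero_left, partialFractionPart_zero_right]; simp
      · have h1 := ih (i + 1) j (by omega)
        have h2 := ih i (j + 1) (by omega)
        rw [partialFractionPart_succ_succ, partialFractionPart_succ_succ]
        linear_combination P ^ i * N ^ j * h + s * h1 + r * h2

lemma partialFractionPart_eq_sum_Icc (r s P : K) (i j : ℕ) :
    partialFractionPart r s P i j =
      ∑ l ∈ Finset.Icc 1 i, ((i - l + j - 1).choose (i - l) : K) * s ^ j * r ^ (i - l) * P ^ l := by
  rw [partialFractionPart]
  refine Finset.sum_nbij' (fun m => i - m) (fun l => i - l) ?_ ?_ ?_ ?_ ?_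
  · intro m hm; simp only [Finset.mem_range, Finset.mem_Icc] at *; omega
  · intro m hm; simp only [Finset.mem_range, Finset.mem_Icc] at *; omega
  · intro m hm; simp only [Finset.mem_range] at *; omega
  · intro m hm; simp only [Finset.mem_Icc] at *; omega
  · intro m hm
    simp only [Finset.mem_range] at hm
    rw [show i - (i - m) = m by omega]

end PartialFractions

/-! ### The coefficients `Q₁` and `Q₂` -/

lemma Q2_eq_Q1 (q1 eta1 eta2 : ℝ) (k l : ℕ) :
    Q2 q1 eta1 eta2 k l = Q1 (1 - q1) eta2 eta1 k l := by
  rw [Q1, Q2]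
  split_ifs
  · rfl
  · refine Finset.sum_congr rfl fun i _ => ?_
    rw [add_comm eta2 eta1, sub_sub_cancel]; ring

/-- Merges the two cases of the definition: the added term `i = k` has binomial factor `0` for `l <
k`, and `C(0,0) = 1` for `l = k` by truncated subtraction. -/
lemma Q1_eq_sum (q1 eta1 eta2 : ℝ) {k l : ℕ} (hl : 1 ≤ l) (hlk : l ≤ k) :
    Q1 q1 eta1 eta2 k l = ∑ i ∈ Finset.Icc l k,
      (k.choose i : ℝ) * q1 ^ i * (1 - q1) ^ (k - i) *
        (((i - l + (k - i) - 1).choose (i - l) : ℝ) * (eta2 / (eta1 + eta2)) ^ (k - i) *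
          (eta1 / (eta1 + eta2)) ^ (i - l)) := by
  rw [Q1]
  split_ifs with h
  · subst h; simp
  · obtain ⟨n, rfl⟩ : ∃ n, k = n + 1 := ⟨k - 1, by omega⟩
    rw [Finset.sum_Icc_succ_top hlk, Nat.choose_eq_zero_of_lt (n := n + 1 - l + (n + 1 - (n + 1)) - 1)
      (by omega)]
    simp only [Nat.cast_zero, zero_mul, mul_zero, add_zero, Nat.add_sub_cancel]
    refine Finset.sum_congr rfl fun i hi => ?_
    rw [Finset.mem_Icc] at hi
    rw [show i - l + (n + 1 - i) - 1 = n + 1 - l - 1 by omega]; ring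

lemma sum_partialFractionPart (q1 eta1 eta2 : ℝ) (P : ℂ) (k : ℕ) :
    ∑ i ∈ Finset.range (k + 1), (k.choose i : ℂ) * q1 ^ i * (1 - q1 : ℂ) ^ (k - i) *
        partialFractionPart (eta1 / (eta1 + eta2) : ℂ) (eta2 / (eta1 + eta2)) P i (k - i) =
      ∑ l ∈ Finset.Icc 1 k, (Q1 q1 eta1 eta2 k l : ℂ) * P ^ l := by
  simp_rw [partialFractionPart_eq_sum_Icc, Finset.mul_sum]
  rw [Finset.sum_comm' (t' := Finset.Icc 1 k) (s' := fun l => Finset.Icc l k)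
    (by intro i l; simp only [Finset.mem_range, Finset.mem_Icc]; omega)]
  refine Finset.sum_congr rfl fun l hl => ?_
  rw [Finset.mem_Icc] at hl
  rw [Q1_eq_sum _ _ _ hl.1 hl.2, Complex.ofReal_sum, Finset.sum_mul]
  refine Finset.sum_congr rfl fun i _ => ?_
  push_cast; ring

lemma add_pow_eq_sum_Q (q1 eta1 eta2 : ℝ) {P N : ℂ}
    (h : P * N = (eta2 / (eta1 + eta2) : ℂ) * P + (eta1 / (eta1 + eta2) : ℂ) * N)
    {k : ℕ} (hk : 1 ≤ k) :
    ((q1 : ℂ) * P + (1 - q1 : ℂ) * N) ^ k =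
      ∑ l ∈ Finset.Icc 1 k, (Q1 q1 eta1 eta2 k l : ℂ) * P ^ l +
        ∑ l ∈ Finset.Icc 1 k, (Q2 q1 eta1 eta2 k l : ℂ) * N ^ l := by
  have hR := sum_partialFractionPart (1 - q1) eta2 eta1 N k
  -- In the `i`-th binomial term `N` has exponent `k - i`, so the sum for `N` is reversed to match.
  rw [← Finset.sum_range_reflect] at hR
  simp_rw [Q2_eq_Q1]
  rw [← sum_partialFractionPart, ← hR, add_pow, ← Finset.sum_add_distrib]
  refine Finset.sum_congr rfl fun i hi => ?_
  have hik : i ≤ k := by rw [Finset.mem_range] at hi; omega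
  rw [show k + 1 - 1 - i = k - i by omega, show k - (k - i) = i by omega,
    Nat.choose_symm hik, mul_pow, mul_pow]
  have := pow_mul_pow_eq_partialFractionPart h (k - 1) i (k - i) (by omega)
  push_cast
  rw [sub_sub_cancel, add_comm (eta2 : ℂ) eta1]
  linear_combination (k.choose i : ℂ) * q1 ^ i * (1 - q1 : ℂ) ^ (k - i) * this

/-! ### Erlang densities and `Hh` -/

lemma integrableOn_pow_mul_exp_neg (n : ℕ) {e : ℝ} (he : 0 < e) :
    IntegrableOn (fun t : ℝ => t ^ n * Real.exp (-(e * t))) (Set.Ioi 0) := by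
  have h := integrableOn_rpow_mul_exp_neg_mul_rpow (p := 1) (s := n) (b := e)
    (by have : (0 : ℝ) ≤ n := n.cast_nonneg
        linarith) one_pos he
  simpa [Real.rpow_natCast, Real.rpow_one] using h

lemma norm_pow_mul_cexp_neg (n : ℕ) (w : ℂ) {t : ℝ} (ht : 0 ≤ t) :
    ‖(t : ℂ) ^ n * Complex.exp (-(w * t))‖ = t ^ n * Real.exp (-(w.re * t)) := by
  rw [norm_mul, norm_pow, Complex.norm_real, Real.norm_of_nonneg ht, Complex.norm_exp]
  simp

lemma integrableOn_pow_mul_cexp_neg (n : ℕ) {w : ℂ} (hw : 0 < w.re) :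
    IntegrableOn (fun t : ℝ => (t : ℂ) ^ n * Complex.exp (-(w * t))) (Set.Ioi 0) := by
  refine (integrableOn_pow_mul_exp_neg n hw).mono' (by fun_prop) ?_
  filter_upwards [ae_restrict_mem measurableSet_Ioi] with t ht
  exact (norm_pow_mul_cexp_neg n w (le_of_lt ht)).le

lemma tendsto_pow_mul_cexp_neg (n : ℕ) {w : ℂ} (hw : 0 < w.re) :
    Filter.Tendsto (fun t : ℝ => (t : ℂ) ^ n * Complex.exp (-(w * t))) Filter.atTop (nhds 0) := by
  rw [tendsto_zero_iff_norm_tendsto_zero]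
  refine (tendsto_rpow_mul_exp_neg_mul_atTop_nhds_zero n w.re hw).congr' ?_
  filter_upwards [Filter.eventually_ge_atTop 0] with t ht
  rw [norm_pow_mul_cexp_neg n w ht, Real.rpow_natCast, neg_mul]

/-- Integration by parts: the derivative of `t^(n+1) e^(-wt)` has integral zero, which relates the
cases `n + 1` and `n`. -/
lemma integral_pow_mul_cexp_neg (n : ℕ) {w : ℂ} (hw : 0 < w.re) :
    ∫ t in Set.Ioi (0 : ℝ), (t : ℂ) ^ n * Complex.exp (-(w * t)) = n.factorial / w ^ (n + 1) := by
  have hw0 : w ≠ 0 := fun h => by simp [h] at hw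
  have hexp : ∀ x : ℝ, HasDerivAt (fun t : ℝ => Complex.exp (-(w * t)))
      (Complex.exp (-(w * x)) * -w) x := by
    intro x
    have h1 : HasDerivAt (fun t : ℝ => -(w * (t : ℂ))) (-w) x := by
      have := ((Complex.ofRealCLM.hasDerivAt (x := x)).const_mul w).neg
      simp only [Complex.ofRealCLM_apply, Complex.ofReal_one, mul_one] at this
      exact this
    exact h1.cexp
  induction n with
  | zero =>
    have hd : ∀ x ∈ Set.Ici (0 : ℝ), HasDerivAt (fun t : ℝ => -w⁻¹ * Complex.exp (-(w * t)))
        ((x : ℂ) ^ 0 * Complex.exp (-(w * x))) x := by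
      intro x _
      refine ((hexp x).const_mul (-w⁻¹)).congr_deriv ?_
      field_simp
    have ht := (tendsto_pow_mul_cexp_neg 0 hw).const_mul (-w⁻¹)
    simp only [pow_zero, one_mul, mul_zero] at ht
    rw [integral_Ioi_of_hasDerivAt_of_tendsto' hd (integrableOn_pow_mul_cexp_neg 0 hw) ht]
    simp
  | succ n ih =>
    have hd : ∀ x ∈ Set.Ici (0 : ℝ), HasDerivAt
        (fun t : ℝ => (t : ℂ) ^ (n + 1) * Complex.exp (-(w * t)))
        ((n + 1 : ℂ) * ((x : ℂ) ^ n * Complex.exp (-(w * x))) -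
          w * ((x : ℂ) ^ (n + 1) * Complex.exp (-(w * x)))) x := by
      intro x _
      have hpow : HasDerivAt (fun t : ℝ => (t : ℂ) ^ (n + 1)) ((n + 1 : ℂ) * (x : ℂ) ^ n) x := by
        have := (Complex.ofRealCLM.hasDerivAt (x := x)).pow (n + 1)
        simp only [Complex.ofRealCLM_apply, Complex.ofReal_one, mul_one, Nat.cast_add,
          Nat.cast_one, Nat.add_sub_cancel] at this
        exact this
      refine (hpow.mul (hexp x)).congr_deriv ?_
      ring
    have i1 := (integrableOn_pow_mul_cexp_neg n hw).const_mul (n + 1 : ℂ)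
    have i2 := (integrableOn_pow_mul_cexp_neg (n + 1) hw).const_mul w
    have h := integral_Ioi_of_hasDerivAt_of_tendsto' hd (i1.sub i2)
      (tendsto_pow_mul_cexp_neg (n + 1) hw)
    rw [integral_sub i1 i2, integral_const_mul, integral_const_mul, ih] at h
    simp only [Complex.ofReal_zero, ne_eq, Nat.add_eq_zero_iff, one_ne_zero, and_false,
      not_false_eq_true, zero_pow, zero_mul, sub_zero] at h
    rw [sub_eq_zero] at h
    rw [← mul_right_inj' hw0, ← h, Nat.factorial_succ]
    push_cast
    field_simp
    ring

/-- The density of the sum of `n + 1` independent exponential variables of rate `e`. -/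
def erlangPdf (e : ℝ) (n : ℕ) (t : ℝ) : ℝ :=
  e ^ (n + 1) / n.factorial * (t ^ n * Real.exp (-(e * t)))

lemma integrable_erlangPdf {e : ℝ} (he : 0 < e) (n : ℕ) :
    Integrable (erlangPdf e n) (volume.restrict (Set.Ioi 0)) :=
  (integrableOn_pow_mul_exp_neg n he).const_mul _

/-- The factor `u` serves both tails: `u = 1` gives powers of `P`, `u = -1` powers of `N`. -/
lemma charInt_erlangPdf_mul {e : ℝ} (he : 0 < e) (n : ℕ) (u η : ℝ) :
    charInt (volume.restrict (Set.Ioi 0)) (erlangPdf e n) (fun t => u * t) η =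
      (e / (e - Complex.I * η * u)) ^ (n + 1) := by
  have hw : 0 < ((e : ℂ) - Complex.I * η * u).re := by simpa using he
  have h := integral_pow_mul_cexp_neg n hw
  have hn : (n.factorial : ℂ) ≠ 0 := by exact_mod_cast n.factorial_ne_zero
  rw [charInt, div_pow]
  calc _ = ∫ t in Set.Ioi (0 : ℝ), ((e : ℂ) ^ (n + 1) / n.factorial) *
        ((t : ℂ) ^ n * Complex.exp (-((e - Complex.I * η * u) * t))) := by
        refine integral_congr_ae (Filter.Eventually.of_forall fun t => ?_)
        simp only [erlangPdf]
        push_cast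
        rw [mul_assoc, mul_assoc, ← Complex.exp_add]
        congr 3; ring
    _ = _ := by
        rw [integral_const_mul, h]
        field_simp

lemma Hh_natCast_eq (n : ℕ) (x : ℝ) :
    Hh (n : ℤ) x =
      1 / n.factorial * ∫ t in Set.Ioi (0 : ℝ), t ^ n * Real.exp (-(1 / 2 * (t + x) ^ 2)) := by
  have h := (measurePreserving_add_right (volume : Measure ℝ) x).setIntegral_preimage_emb
    (measurableEmbedding_addRight x)
    (fun y => (y - x) ^ n * Real.exp (-(1 / 2 * y ^ 2))) (Set.Ioi x)
  rw [Set.preimage_add_const_Ioi, sub_self] at h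
  simp only [add_sub_cancel_right] at h
  rw [h]
  rfl

/-- Rescale `t` by the standard deviation `√(2a)` and complete the square; the leftover constant is
`exp(ec + e²a)`. -/
lemma integral_erlangPdf_mul_gaussian {a e : ℝ} (ha : 0 < a) (n : ℕ) (c : ℝ) :
    ∫ t in Set.Ioi (0 : ℝ), erlangPdf e n t * Real.exp (-((c + t) ^ 2 / (4 * a))) =
      (e * Real.sqrt (2 * a)) ^ (n + 1) * Real.exp (e * c + e ^ 2 * a) *
        Hh (n : ℤ) (e * Real.sqrt (2 * a) + c / Real.sqrt (2 * a)) := by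
  set v := Real.sqrt (2 * a) with hv
  have hv0 : 0 < v := Real.sqrt_pos.2 (by positivity)
  have hv2 : v ^ 2 = 2 * a := Real.sq_sqrt (by positivity)
  have ha' : a = v ^ 2 / 2 := by linarith
  have h := integral_comp_mul_left_Ioi
    (fun t => erlangPdf e n t * Real.exp (-((c + t) ^ 2 / (4 * a)))) 0 hv0
  rw [mul_zero, smul_eq_mul] at h
  rw [Hh_natCast_eq, ← mul_right_inj' (inv_pos.2 hv0).ne', ← h, ← integral_const_mul,
    ← integral_const_mul, ← integral_const_mul]
  refine integral_congr_ae (Filter.Eventually.of_forall fun t => ?_)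
  simp only [erlangPdf]
  have hE : Real.exp (-(e * (v * t))) * Real.exp (-((c + v * t) ^ 2 / (4 * a))) =
      Real.exp (e * c + e ^ 2 * a) * Real.exp (-(1 / 2 * (t + (e * v + c / v)) ^ 2)) := by
    rw [← Real.exp_add, ← Real.exp_add, ha']
    congr 1
    field_simp
    ring
  calc _ = e ^ (n + 1) / n.factorial * (v * t) ^ n *
        (Real.exp (-(e * (v * t))) * Real.exp (-((c + v * t) ^ 2 / (4 * a)))) := by ring
    _ = _ := by
        rw [hE, mul_pow, mul_pow, pow_succ v]
        field_simp

/-! ### Double-exponential jumps -/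

lemma doubleExpPdf_eq_piecewise (q1 eta1 eta2 : ℝ) :
    doubleExpPdf q1 eta1 eta2 = (Set.Ici (0 : ℝ)).piecewise
      (fun y => q1 * eta1 * Real.exp (-(eta1 * y)))
      (fun y => (1 - q1) * eta2 * Real.exp (eta2 * y)) := by
  ext y
  simp only [doubleExpPdf, Set.piecewise, Set.mem_Ici]

lemma integrableOn_exp_neg_mul_Ici {e : ℝ} (he : 0 < e) :
    IntegrableOn (fun y : ℝ => Real.exp (-(e * y))) (Set.Ici 0) := by
  rw [integrableOn_Ici_iff_integrableOn_Ioi]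
  simpa using integrableOn_pow_mul_exp_neg 0 he

lemma integrableOn_exp_mul_compl_Ici {e : ℝ} (he : 0 < e) :
    IntegrableOn (fun y : ℝ => Real.exp (e * y)) (Set.Ici 0)ᶜ := by
  rw [Set.compl_Ici]
  exact (integrableOn_exp_mul_Iic he 0).mono_set Set.Iio_subset_Iic_self

lemma integrable_doubleExpPdf (q1 : ℝ) {eta1 eta2 : ℝ} (h1 : 0 < eta1) (h2 : 0 < eta2) :
    Integrable (doubleExpPdf q1 eta1 eta2) := by
  rw [doubleExpPdf_eq_piecewise]
  exact Integrable.piecewise measurableSet_Ici ((integrableOn_exp_neg_mul_Ici h1).const_mul _)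
    ((integrableOn_exp_mul_compl_Ici h2).const_mul _)

/-- Weighting by `e^y` changes the rates to `η₁ - 1` and `η₂ + 1`, whence `η₁ > 1`. -/
lemma integrable_exp_sub_one_mul_doubleExpPdf (q1 : ℝ) {eta1 eta2 : ℝ} (h1 : 1 < eta1)
    (h2 : 0 < eta2) :
    Integrable (fun y => (Real.exp y - 1) * doubleExpPdf q1 eta1 eta2 y) := by
  have h : Integrable ((Set.Ici (0 : ℝ)).piecewise
      (fun y => q1 * eta1 * Real.exp (-((eta1 - 1) * y)))
      (fun y => (1 - q1) * eta2 * Real.exp ((eta2 + 1) * y))) :=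
    Integrable.piecewise measurableSet_Ici
      ((integrableOn_exp_neg_mul_Ici (sub_pos.2 h1)).const_mul _)
      ((integrableOn_exp_mul_compl_Ici (by linarith)).const_mul _)
  refine (h.sub (integrable_doubleExpPdf q1 (zero_lt_one.trans h1) h2)).congr
    (Filter.Eventually.of_forall fun y => ?_)
  rw [doubleExpPdf_eq_piecewise]
  by_cases hy : y ∈ Set.Ici (0 : ℝ)
  · simp only [Pi.sub_apply, Set.piecewise_eq_of_mem _ _ _ hy]
    rw [show -((eta1 - 1) * y) = y + -(eta1 * y) by ring, Real.exp_add]; ring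
  · simp only [Pi.sub_apply, Set.piecewise_eq_of_notMem _ _ _ hy]
    rw [show (eta2 + 1) * y = y + eta2 * y by ring, Real.exp_add]; ring

lemma jumpCharFun_kou (mu sigma lam q1 : ℝ) {eta1 eta2 : ℝ} (h1 : 0 < eta1) (h2 : 0 < eta2)
    (η : ℝ) :
    (kou mu sigma lam q1 eta1 eta2).jumpCharFun η =
      (q1 : ℂ) * (eta1 / (eta1 - Complex.I * η)) +
        (1 - q1 : ℂ) * (eta2 / (eta2 + Complex.I * η)) := by
  have hint : Integrable (fun y : ℝ =>
      (doubleExpPdf q1 eta1 eta2 y : ℂ) * Complex.exp (Complex.I * η * y)) :=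
    (integrable_doubleExpPdf q1 h1 h2).ofReal.mul_bdd (c := 1) (by fun_prop)
      (Filter.Eventually.of_forall fun y => (norm_exp_I_mul_mul _ _).le)
  have e1 := charInt_erlangPdf_mul h1 0 1 η
  have e2 := charInt_erlangPdf_mul h2 0 (-1) η
  rw [zero_add, pow_one] at e1 e2
  rw [Model.jumpCharFun]
  simp only [kou]
  rw [← integral_add_compl measurableSet_Ici hint (s := Set.Ici 0), Set.compl_Ici,
    integral_Ici_eq_integral_Ioi, ← integral_Iic_eq_integral_Iio]
  congr 1
  · rw [show (eta1 : ℂ) - Complex.I * η = eta1 - Complex.I * η * (1 : ℝ) by simp, ← e1, charInt,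
      ← integral_const_mul]
    refine setIntegral_congr_fun measurableSet_Ioi fun y hy => ?_
    simp only [doubleExpPdf, if_pos (le_of_lt (Set.mem_Ioi.1 hy)), erlangPdf]
    push_cast; simp; ring
  · rw [show (eta2 : ℂ) + Complex.I * η = eta2 - Complex.I * η * (-1 : ℝ) by simp, ← e2, charInt,
      ← integral_const_mul, integral_Iic_eq_integral_Iio]
    -- Reflection carries the negative tail to an exponential density on the positive half-line.
    have hneg := integral_comp_neg_Iic (0 : ℝ) (fun t : ℝ => (1 - q1 : ℂ) *
      ((erlangPdf eta2 0 t : ℂ) * Complex.exp (Complex.I * η * ((-1 * t : ℝ) : ℂ))))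
    rw [neg_zero] at hneg
    rw [← hneg, integral_Iic_eq_integral_Iio]
    refine setIntegral_congr_fun measurableSet_Iio fun y hy => ?_
    simp only [doubleExpPdf, if_neg (not_le.2 (Set.mem_Iio.1 hy)), erlangPdf]
    push_cast; simp; ring

lemma integral_gaussChar_mul_erlang {a e : ℝ} (ha : 0 < a) (he : 0 < e) (n : ℕ) (c u : ℝ)
    (hu : u ^ 2 = 1) :
    ∫ η, gaussChar a c η * ((e : ℂ) / (e - Complex.I * η * u)) ^ (n + 1) =
      ((Real.sqrt (Real.pi / a) * ((e * Real.sqrt (2 * a)) ^ (n + 1) *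
        Real.exp (e * (u * c) + e ^ 2 * a) *
        Hh (n : ℤ) (e * Real.sqrt (2 * a) + u * c / Real.sqrt (2 * a))) : ℝ) : ℂ) := by
  simp_rw [← charInt_erlangPdf_mul he]
  rw [integral_gaussChar_mul_charInt (integrable_erlangPdf he n) (by fun_prop) ha,
    ← integral_erlangPdf_mul_gaussian ha n (u * c)]
  congr 5; ext t
  congr 4
  -- Since `u² = 1`, `(c + ut)² = (uc + t)²`.
  linear_combination (t ^ 2 - c ^ 2) * hu

lemma integrable_gaussChar_mul_erlang {a e : ℝ} (ha : 0 < a) (he : 0 < e) (n : ℕ) (c u : ℝ) :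
    Integrable fun η : ℝ => gaussChar a c η * ((e : ℂ) / (e - Complex.I * η * u)) ^ (n + 1) := by
  simp_rw [← charInt_erlangPdf_mul he]
  exact integrable_gaussChar_mul_charInt (integrable_erlangPdf he n) (by fun_prop) ha c

lemma integral_gaussChar_mul_sum_erlang {a e : ℝ} (ha : 0 < a) (he : 0 < e) (c u : ℝ)
    (hu : u ^ 2 = 1) (k : ℕ) (Q : ℕ → ℝ) :
    Integrable (fun η : ℝ => gaussChar a c η *
      ∑ l ∈ Finset.Icc 1 k, (Q l : ℂ) * ((e : ℂ) / (e - Complex.I * η * u)) ^ l) ∧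
    ∫ η : ℝ, gaussChar a c η *
        ∑ l ∈ Finset.Icc 1 k, (Q l : ℂ) * ((e : ℂ) / (e - Complex.I * η * u)) ^ l =
      ((Real.sqrt (Real.pi / a) * ∑ l ∈ Finset.Icc 1 k, Q l * (e * Real.sqrt (2 * a)) ^ l *
        Real.exp (e * (u * c) + e ^ 2 * a) *
        Hh ((l : ℤ) - 1) (e * Real.sqrt (2 * a) + u * c / Real.sqrt (2 * a)) : ℝ) : ℂ) := by
  have hrw : (fun η : ℝ => gaussChar a c η *
      ∑ l ∈ Finset.Icc 1 k, (Q l : ℂ) * ((e : ℂ) / (e - Complex.I * η * u)) ^ l) =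
      fun η : ℝ => ∑ l ∈ Finset.Icc 1 k, (Q l : ℂ) * (gaussChar a c η *
        ((e : ℂ) / (e - Complex.I * η * u)) ^ l) := by
    ext η
    rw [Finset.mul_sum]
    exact Finset.sum_congr rfl fun l _ => by ring
  have hi : ∀ l ∈ Finset.Icc 1 k, Integrable (fun η : ℝ => (Q l : ℂ) * (gaussChar a c η *
        ((e : ℂ) / (e - Complex.I * η * u)) ^ l)) := by
    intro l hl
    -- As `l ≥ 1`, the power is an Erlang one and the `Hh` index `l - 1 = n` is nonnegative.
    obtain ⟨n, rfl⟩ : ∃ n, l = n + 1 := ⟨l - 1, by rw [Finset.mem_Icc] at hl; omega⟩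
    exact (integrable_gaussChar_mul_erlang ha he n c u).const_mul _
  rw [hrw]
  refine ⟨integrable_finsetSum _ hi, ?_⟩
  rw [integral_finsetSum _ hi, Finset.mul_sum, Complex.ofReal_sum]
  refine Finset.sum_congr rfl fun l hl => ?_
  obtain ⟨n, rfl⟩ : ∃ n, l = n + 1 := ⟨l - 1, by rw [Finset.mem_Icc] at hl; omega⟩
  rw [integral_const_mul, integral_gaussChar_mul_erlang ha he n c u hu,
    show ((n + 1 : ℕ) : ℤ) - 1 = n by push_cast; ring]
  push_cast; ring

lemma kou_seriesTerm {sigma dt eta1 eta2 : ℝ} (hs : 0 < sigma) (hdt : 0 < dt) (h1 : 0 < eta1)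
    (h2 : 0 < eta2) (mu lam q1 : ℝ) {k : ℕ} (hk : 1 ≤ k) (s : ℝ) :
    (kou mu sigma lam q1 eta1 eta2).seriesTerm dt k s =
      kouDeltaG mu sigma lam q1 eta1 eta2 dt k s := by
  have hsM : 0 < (kou mu sigma lam q1 eta1 eta2).sigma := hs
  have ha := Model.alpha_pos hsM hdt
  apply Complex.ofReal_injective
  rw [Model.integral_gaussChar_mul_jumpCharFun_pow hsM hdt (integrable_doubleExpPdf q1 h1 h2)]
  simp_rw [jumpCharFun_kou _ _ _ _ h1 h2]
  simp only [kouDeltaG]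
  set M := kou mu sigma lam q1 eta1 eta2
  have hlam : M.lam = lam := rfl
  set a := M.alpha dt
  set b := M.beta dt
  obtain ⟨i1, I1⟩ := integral_gaussChar_mul_sum_erlang ha h1 (b + s) 1 (by norm_num) k
    (Q1 q1 eta1 eta2 k)
  obtain ⟨i2, I2⟩ := integral_gaussChar_mul_sum_erlang ha h2 (b + s) (-1) (by norm_num) k
    (Q2 q1 eta1 eta2 k)
  have hpow : ∀ η : ℝ, gaussChar a (b + s) η * ((q1 : ℂ) * (eta1 / (eta1 - Complex.I * η)) +
        (1 - q1 : ℂ) * (eta2 / (eta2 + Complex.I * η))) ^ k =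
      gaussChar a (b + s) η * ∑ l ∈ Finset.Icc 1 k, (Q1 q1 eta1 eta2 k l : ℂ) *
        ((eta1 : ℂ) / (eta1 - Complex.I * η * (1 : ℝ))) ^ l +
      gaussChar a (b + s) η * ∑ l ∈ Finset.Icc 1 k, (Q2 q1 eta1 eta2 k l : ℂ) *
        ((eta2 : ℂ) / (eta2 - Complex.I * η * (-1 : ℝ))) ^ l := by
    intro η
    have n1 : (eta1 : ℂ) - Complex.I * η ≠ 0 := fun h => by
      have := congrArg Complex.re h
      simp at this; exact h1.ne' this
    have n2 : (eta2 : ℂ) + Complex.I * η ≠ 0 := fun h => by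
      have := congrArg Complex.re h
      simp at this; exact h2.ne' this
    have n3 : (eta1 : ℂ) + eta2 ≠ 0 := by exact_mod_cast (add_pos h1 h2).ne'
    -- The relation to check amounts to `(η₂/(η₁+η₂))/N + (η₁/(η₁+η₂))/P = 1`: the terms in `iη`
    -- cancel.
    rw [add_pow_eq_sum_Q q1 eta1 eta2 (by field_simp; ring) hk, mul_add]
    push_cast
    simp only [mul_one, mul_neg, sub_neg_eq_add]
  simp_rw [hpow]
  rw [integral_add i1 i2, I1, I2, ← Complex.ofReal_add, ← Complex.ofReal_mul, hlam,
    div_eq_mul_one_div (Real.exp _) (Real.sqrt _), Model.one_div_sqrt_four_pi_mul ha]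
  congr 1
  simp only [one_mul, neg_one_mul, mul_neg, neg_div, ← sub_eq_add_neg]
  ring

/-! ### `Hh_0` and the normal distribution function -/

lemma Hh_zero_eq_cdf (x : ℝ) :
    Hh 0 x = Real.sqrt (2 * Real.pi) *
      ProbabilityTheory.cdf (ProbabilityTheory.gaussianReal 0 1) (-x) := by
  rw [ProbabilityTheory.cdf_eq_real, Measure.real,
    ProbabilityTheory.gaussianReal_apply_eq_integral 0 one_ne_zero, ENNReal.toReal_ofReal
      (integral_nonneg fun y => ProbabilityTheory.gaussianPDFReal_nonneg 0 1 y)]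
  -- The density is even, so the lower tail at `-x` equals the upper tail at `x`.
  have hneg := integral_comp_neg_Iic (-x) (fun y => ProbabilityTheory.gaussianPDFReal 0 1 y)
  have heven : ∀ y, ProbabilityTheory.gaussianPDFReal 0 1 (-y) =
      ProbabilityTheory.gaussianPDFReal 0 1 y := by
    intro y; simp [ProbabilityTheory.gaussianPDFReal]
  simp_rw [heven, neg_neg] at hneg
  rw [hneg, ← integral_const_mul]
  change 1 / ((0 : ℕ).factorial : ℝ) * ∫ y in Set.Ioi x, (y - x) ^ 0 *
    Real.exp (-(1 / 2 * y ^ 2)) = _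
  rw [Nat.factorial_zero, Nat.cast_one, div_one, one_mul]
  refine integral_congr_ae (Filter.Eventually.of_forall fun y => ?_)
  have hpos : Real.sqrt (2 * Real.pi) ≠ 0 := by positivity
  simp only [ProbabilityTheory.gaussianPDFReal, pow_zero, one_mul, NNReal.coe_one, mul_one,
    sub_zero]
  rw [mul_inv_cancel_left₀ hpos]
  congr 1; ring

end JumpDiffusion

end

theorem corollary3p1 (mu sigma lam dt : ℝ) (hsigma : 0 < sigma) (hlam : 0 ≤ lam) (hdt : 0 < dt) :
    -- normal jumps with mean m and standard deviation v
    (∀ m v : ℝ, 0 < v →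
      Integrable (fun y => (Real.exp y - 1) * JumpDiffusion.normalPdf m v y) ∧
      Integrable ((JumpDiffusion.merton mu sigma lam m v).bigG dt) ∧
      ∀ s : ℝ,
        (JumpDiffusion.merton mu sigma lam m v).density dt s =
          ((JumpDiffusion.merton mu sigma lam m v).gInf dt s : ℂ) ∧
        (∀ k : ℕ, Integrable ((JumpDiffusion.merton mu sigma lam m v).seriesIntegrand dt k s)) ∧
        (JumpDiffusion.merton mu sigma lam m v).seriesTerm dt 0 s =
          (JumpDiffusion.merton mu sigma lam m v).gZero dt s ∧
        (∀ k : ℕ, 1 ≤ k →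
          (JumpDiffusion.merton mu sigma lam m v).seriesTerm dt k s =
            JumpDiffusion.mertonDeltaG mu sigma lam m v dt k s) ∧
        Summable (fun k : ℕ => JumpDiffusion.mertonDeltaG mu sigma lam m v dt (k + 1) s) ∧
        (JumpDiffusion.merton mu sigma lam m v).gInf dt s =
          (JumpDiffusion.merton mu sigma lam m v).gZero dt s +
            ∑' k : ℕ, JumpDiffusion.mertonDeltaG mu sigma lam m v dt (k + 1) s) ∧
    -- asymmetric double-exponential jumps
    (∀ q1 eta1 eta2 : ℝ, 0 < q1 → q1 < 1 → 1 < eta1 → 0 < eta2 →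
      Integrable (fun y => (Real.exp y - 1) * JumpDiffusion.doubleExpPdf q1 eta1 eta2 y) ∧
      Integrable ((JumpDiffusion.kou mu sigma lam q1 eta1 eta2).bigG dt) ∧
      ∀ s : ℝ,
        (JumpDiffusion.kou mu sigma lam q1 eta1 eta2).density dt s =
          ((JumpDiffusion.kou mu sigma lam q1 eta1 eta2).gInf dt s : ℂ) ∧
        (∀ k : ℕ,
          Integrable ((JumpDiffusion.kou mu sigma lam q1 eta1 eta2).seriesIntegrand dt k s)) ∧
        (JumpDiffusion.kou mu sigma lam q1 eta1 eta2).seriesTerm dt 0 s =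
          (JumpDiffusion.kou mu sigma lam q1 eta1 eta2).gZero dt s ∧
        (∀ k : ℕ, 1 ≤ k →
          (JumpDiffusion.kou mu sigma lam q1 eta1 eta2).seriesTerm dt k s =
            JumpDiffusion.kouDeltaG mu sigma lam q1 eta1 eta2 dt k s) ∧
        Summable (fun k : ℕ => JumpDiffusion.kouDeltaG mu sigma lam q1 eta1 eta2 dt (k + 1) s) ∧
        (JumpDiffusion.kou mu sigma lam q1 eta1 eta2).gInf dt s =
          (JumpDiffusion.kou mu sigma lam q1 eta1 eta2).gZero dt s +
            ∑' k : ℕ, JumpDiffusion.kouDeltaG mu sigma lam q1 eta1 eta2 dt (k + 1) s) ∧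
    -- the values of Hh at the indices -1 and 0
    (∀ x : ℝ, JumpDiffusion.Hh (-1) x = Real.exp (-(x ^ 2 / 2)) ∧
      JumpDiffusion.Hh 0 x =
        Real.sqrt (2 * Real.pi) *
          ProbabilityTheory.cdf (ProbabilityTheory.gaussianReal 0 1) (-x)) := by
  refine ⟨fun m v hv => ?_, fun q1 eta1 eta2 _ _ h1 h2 => ?_, fun x => ?_⟩
  · have hp := JumpDiffusion.integrable_normalPdf m v
    exact ⟨JumpDiffusion.integrable_exp_sub_one_mul_normalPdf m hv,
      JumpDiffusion.Model.integrable_bigG hsigma hdt hp, fun s =>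
      JumpDiffusion.Model.series_representation hsigma hdt hp s
        (fun k => JumpDiffusion.mertonDeltaG mu sigma lam m v dt k s)
        fun k _ => JumpDiffusion.merton_seriesTerm hsigma hdt mu lam m hv k s⟩
  · have h1' : 0 < eta1 := zero_lt_one.trans h1
    have hp := JumpDiffusion.integrable_doubleExpPdf q1 h1' h2
    exact ⟨JumpDiffusion.integrable_exp_sub_one_mul_doubleExpPdf q1 h1 h2,
      JumpDiffusion.Model.integrable_bigG hsigma hdt hp, fun s =>
      JumpDiffusion.Model.series_representation hsigma hdt hp s
        (fun k => JumpDiffusion.kouDeltaG mu sigma lam q1 eta1 eta2 dt k s)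
        fun k hk => JumpDiffusion.kou_seriesTerm hsigma hdt h1' h2 mu lam q1 hk s⟩
  · exact ⟨rfl, JumpDiffusion.Hh_zero_eq_cdf x⟩
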